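/- Let $G$ be a locally compact (Hausdorff) group with left Haar measure $\lambda_G$ (a Radon measure), and assume that $G$ is amenable, i.e. there is a left-invariant mean on $L^\infty(G)$. Let $K$ be a compact subgroup of $G$ with normalised Haar measure $\lambda_K$, $\lambda_K(K)=1$, and let $\mu$ be the $G$-invariant Radon measure on $G/K$ normalised by $$\int_G f(g)\,d\lambda_G(g)=\int_{G/K}\int_K f(gk)\,d\lambda_K(k)\,d\mu(gK)\qquad (f\in C_c(G)).$$ Let $U\subset G$ be a closed neighbourhood of the identity with $\lambda_G(U)<\infty$, and let $V\subset G$ be closed; assume that both are symmetric ($U^{-1}=U$, $V^{-1}=V$) and $K$-bi-invariant ($KUK=U$, $KVK=V$). Let $\mathcal F_{G/K}(U,V)$ be the set of all continuous kernels $\Phi:G/K\times G/K\to\mathbb R$ that are positive definite ($\sum_{i,j=1}^n\Phi(x_iK,x_jK)a_i\overline{a_j}\ge 0$ for all $n\in\mathbb N$, $x_i\in G$, $a_i\in\mathbb C$), $G$-invariant ($\Phi(gxK,gyK)=\Phi(xK,yK)$ for all $g,x,y\in G$), normalised by $\Phi(xK,xK)=1$ for all $x\in G$, and satisfy $\operatorname{supp}\Phi_+\subset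 U$ and $\operatorname{supp}\Phi_-\subset V$. Here $\Phi_\pm=\max\{\pm\Phi,0\}$ and $\operatorname{supp}\Psi=\overline{\{g\in G:\Psi(K,gK)\neq 0\}}\subset G$ for a $G$-invariant kernel $\Psi$. Put $$\mathcal C_{G/K}(U,V):=\sup_{\Phi\in\mathcal F_{G/K}(U,V)}\int_{G/K}\Phi(xK,yK)\,d\mu(yK),$$ where $x\in G$ is arbitrary (the integral does not depend on $x$) and the integral is understood in the extended sense $\int\Phi_+-\int\Phi_-\in[-\infty,\infty)$. Then the supremum is finite and attained: there exists $\Phi\in\mathcal F_{G/K}(U,V)$ such that, for every $x\in G$, the function $yK\mapsto\Phi(xK,yK)$ is $\mu$-integrable and $$\int_{G/K}\Phi(xK,yK)\,d\mu(yK)=\mathcal C_{G/K}(U,V).$$ -/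

import Mathlib

open MeasureTheory Topology
open scoped ENNReal ComplexOrder

noncomputable section

namespace Delsarte

variable {G : Type*} [Group G]

section Amenable

variable [TopologicalSpace G] [IsTopologicalGroup G] [MeasurableSpace G] [BorelSpace G]

/-- A linear functional on the real space `L^∞(G)` is a mean if it is positive and takes the value
`1` at the constant function `1`. -/
def IsMean {lam : Measure G} (M : Lp ℝ ∞ lam →ₗ[ℝ] ℝ) : Prop :=
  (∀ f, 0 ≤ f → 0 ≤ M f) ∧ M (memLp_top_const (μ := lam) (1 : ℝ)).toLp = 1

/-- Left translation `f ↦ (x ↦ f (g * x))` on `L^∞(G)`. -/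
def leftTranslate (lam : Measure G) [lam.IsHaarMeasure] (g : G) (f : Lp ℝ ∞ lam) : Lp ℝ ∞ lam :=
  Lp.compMeasurePreserving (fun x => g * x) (measurePreserving_mul_left lam g) f

/-- A locally compact group with Haar measure `lam` is amenable if there is a left-invariant mean on
`L^∞(G)`. -/
def IsAmenable (lam : Measure G) [lam.IsHaarMeasure] : Prop :=
  ∃ M : Lp ℝ ∞ lam →ₗ[ℝ] ℝ, IsMean M ∧ ∀ g f, M (leftTranslate lam g f) = M f

end Amenable

/-- A subset `S` of `G` is `K`-bi-invariant if its indicator function is, i.e. `S = KSK`. -/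
def IsBiInvariant (K : Subgroup G) (S : Set G) : Prop :=
  ∀ k ∈ K, ∀ k' ∈ K, ∀ g, k * g * k' ∈ S ↔ g ∈ S

/-- A subset `S` of `G` is symmetric if `S⁻¹ = S`. -/
def IsSymmetric (S : Set G) : Prop :=
  ∀ g, g⁻¹ ∈ S ↔ g ∈ S

section QuotientMeasure

variable [TopologicalSpace G] [MeasurableSpace G]

/-- `mu` is the `G`-invariant Radon measure on `G/K` normalised by
`∫_G f dλ_G = ∫_{G/K} ∫_K f(gk) dλ_K(k) dμ(gK)` for all `f ∈ C_c(G)`. The inner integral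
does not depend on the representative `g` of the coset, since `lamK` is left-invariant. -/
structure IsQuotientMeasure (K : Subgroup G) [MeasurableSpace (G ⧸ K)]
    (lam : Measure G) (lamK : Measure K) (mu : Measure (G ⧸ K)) : Prop where
  regular : mu.Regular
  invariant : SMulInvariantMeasure G (G ⧸ K) mu
  integral_eq : ∀ f : G → ℝ, Continuous f → HasCompactSupport f →
    ∫ g, f g ∂lam = ∫ x : G ⧸ K, ∫ k : K, f (Quotient.out x * (k : G)) ∂lamK ∂mu

end QuotientMeasure

section Kernels

variable {K : Subgroup G}

/-- Positive definiteness of a real-valued kernel, tested with complex coefficients.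
The inequality `0 ≤ z` in `ℂ` says that `z` is real and nonnegative. -/
def IsPosDefKernel {X : Type*} (Phi : X → X → ℝ) : Prop :=
  ∀ (n : ℕ) (x : Fin n → X) (a : Fin n → ℂ),
    0 ≤ ∑ i, ∑ j, (Phi (x i) (x j) : ℂ) * a i * (starRingEnd ℂ) (a j)

/-- `G`-invariance of a kernel on `G/K`. -/
def IsInvariantKernel (Phi : G ⧸ K → G ⧸ K → ℝ) : Prop :=
  ∀ (g : G) (x y : G ⧸ K), Phi (g • x) (g • y) = Phi x y

/-- The positive part of a kernel. -/
def posPartKernel {X : Type*} (Phi : X → X → ℝ) : X → X → ℝ := fun x y => max (Phi x y) 0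

/-- The negative part of a kernel. -/
def negPartKernel {X : Type*} (Phi : X → X → ℝ) : X → X → ℝ := fun x y => max (-Phi x y) 0

variable [TopologicalSpace G]

/-- The support of a `G`-invariant kernel, a closed subset of `G`: the closure of the set of all
`g` with `Phi(K, gK) ≠ 0`. -/
def kernelSupport (Phi : G ⧸ K → G ⧸ K → ℝ) : Set G :=
  closure {g : G | Phi ((1 : G) : G ⧸ K) (g : G ⧸ K) ≠ 0}

/-- The class of continuous positive definite `G`-invariant kernels on `G/K` with
`Phi(x, x) = 1` for all `x`, with `supp Phi₊ ⊆ U` and `supp Phi₋ ⊆ V`. -/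
structure IsAdmissible (U V : Set G) (Phi : G ⧸ K → G ⧸ K → ℝ) : Prop where
  continuous : Continuous (Function.uncurry Phi)
  posDef : IsPosDefKernel Phi
  invariant : IsInvariantKernel Phi
  diag : ∀ x, Phi x x = 1
  supp_pos : kernelSupport (posPartKernel Phi) ⊆ U
  supp_neg : kernelSupport (negPartKernel Phi) ⊆ V

/-- The integral of a real function as an extended real number, `∫ f₊ - ∫ f₋`. For admissible
kernels and `U` of finite measure, `∫ f₊` is finite, so that the value lies in `[-∞, ∞)`. -/
def extIntegral {X : Type*} [MeasurableSpace X] (mu : Measure X) (f : X → ℝ) : EReal :=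
  ((∫⁻ y, ENNReal.ofReal (f y) ∂mu : ℝ≥0∞) : EReal) -
    ((∫⁻ y, ENNReal.ofReal (-f y) ∂mu : ℝ≥0∞) : EReal)

/-- The Delsarte constant: the supremum of `∫_{G/K} Phi(x, y) dμ(y)` over all admissible kernels.
It is computed at a base point `x ∈ G/K`, on which it does not depend. -/
def delsarteConstant [MeasurableSpace (G ⧸ K)] (mu : Measure (G ⧸ K)) (U V : Set G)
    (x : G ⧸ K) : EReal :=
  ⨆ (Phi : G ⧸ K → G ⧸ K → ℝ) (_ : IsAdmissible U V Phi), extIntegral mu (Phi x)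

end Kernels

end Delsarte

end

open Filter
open scoped InnerProductSpace

namespace Delsarte

universe u

set_option linter.unusedSectionVars false

/-! An admissible kernel is determined by `phi g = Phi(K, gK)`, a continuous `K`-bi-invariant
function of positive type on `G` with the same integral, so the problem can be solved on `G`.
Functions in a maximising sequence are bounded by 1; as functionals on `L¹(G)` they have a weak-*
limit along an ultrafilter (`exists_weak_limit`). Positive type survives because the form attached
to a functional is itself a value of that functional (`functionalForm_eq`), and a GNS construction
turns the limit into a continuous function `psi` with `psi 1 ≤ 1` (`exists_function_of_functional`).

The integral is upper semicontinuous along this limit: admissible functions are nonpositive off `U`,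
so their integral is at most the one over any `C ⊇ U` of finite measure, and integrals over such `C`
converge. Letting `C` grow shows that the supremum `S` is at most the integral of `psi`. Since `S >
0` (a normalised `λ(A ∩ xA)` competes), `psi` is not zero, and dividing by `psi 1 ≤ 1` restores the
normalisation without lowering the integral (`exists_maximal_admissibleFunction`). -/

/-! ### Positive definite kernels and Hilbert spaces -/

/-- A positive semidefinite symmetric bilinear form is the pullback of the inner product of a real
Hilbert space under a linear map with dense range. -/
theorem exists_hilbert_of_bilin {E : Type u} [AddCommGroup E] [Module ℝ E]
    (B : E →ₗ[ℝ] E →ₗ[ℝ] ℝ) (hsymm : ∀ x y, B x y = B y x) (hpos : ∀ x, 0 ≤ B x x) :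
    ∃ (H : Type u) (_ : NormedAddCommGroup H) (_ : InnerProductSpace ℝ H) (_ : CompleteSpace H)
      (j : E →ₗ[ℝ] H), DenseRange j ∧ ∀ x y, ⟪j x, j y⟫_ℝ = B x y := by
  let c : PreInnerProductSpace.Core ℝ E :=
    { inner := fun x y => B x y
      conj_inner_symm := fun x y => by simpa using hsymm y x
      re_inner_nonneg := fun x => by simpa using hpos x
      add_left := fun x y z => by simp
      smul_left := fun x y r => by simp }
  let _ : SeminormedAddCommGroup E := InnerProductSpace.Core.toSeminormedAddCommGroup (𝕜 := ℝ) (c := c)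
  let _ : InnerProductSpace ℝ E := InnerProductSpace.ofCore c
  refine ⟨UniformSpace.Completion E, inferInstance, inferInstance, inferInstance,
    (UniformSpace.Completion.toComplL (𝕜 := ℝ) (E := E)).toLinearMap,
    UniformSpace.Completion.denseRange_coe, fun x y => ?_⟩
  exact UniformSpace.Completion.inner_coe x y

/-- By density the bound extends to all vectors, in particular to `w` itself. -/
theorem norm_le_of_denseRange_inner {E H : Type*} [NormedAddCommGroup H] [InnerProductSpace ℝ H]
    {j : E → H} (hj : DenseRange j) {w : H} {C : ℝ} (hC : 0 ≤ C)
    (h : ∀ f, ⟪w, j f⟫_ℝ ≤ C * ‖j f‖) : ‖w‖ ≤ C := by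
  have key : ⟪w, w⟫_ℝ ≤ C * ‖w‖ :=
    hj.induction_on (p := fun z => ⟪w, z⟫_ℝ ≤ C * ‖z‖) w
      (isClosed_le (by fun_prop) (by fun_prop)) h
  rw [real_inner_self_eq_norm_sq] at key
  rcases (norm_nonneg w).eq_or_lt' with h0 | h0
  · rwa [h0]
  · nlinarith

theorem IsPosDefKernel.symm {X : Type*} {Phi : X → X → ℝ} (h : IsPosDefKernel Phi) (x y : X) :
    Phi x y = Phi y x := by
  -- With coefficients `1` and `i`, the vanishing imaginary part is the difference of the two
  -- off-diagonal values.
  have h1 := h 2 ![x, y] ![1, Complex.I]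
  have h2 := (Complex.le_def.1 h1).2
  simp [Fin.sum_univ_two] at h2
  linarith

theorem IsPosDefKernel.sum_nonneg {X : Type*} {Phi : X → X → ℝ} (h : IsPosDefKernel Phi)
    (s : Finset X) (a : X → ℝ) : 0 ≤ ∑ x ∈ s, ∑ y ∈ s, a x * (a y * Phi x y) := by
  have h1 := h s.card (fun i => (s.equivFin.symm i : X)) (fun i => (a (s.equivFin.symm i) : ℂ))
  have h2 : ∀ f : X → ℝ, ∑ x ∈ s, f x = ∑ i, f (s.equivFin.symm i) := fun f => by
    rw [← Finset.sum_coe_sort s, ← Equiv.sum_comp s.equivFin.symm]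
  simp only [h2]
  have h3 := (Complex.le_def.1 h1).1
  rw [Complex.zero_re] at h3
  convert h3 using 1
  rw [Complex.re_sum]
  refine Finset.sum_congr rfl fun i _ => ?_
  rw [Complex.re_sum]
  refine Finset.sum_congr rfl fun j _ => ?_
  rw [Complex.conj_ofReal, ← Complex.ofReal_mul, ← Complex.ofReal_mul, Complex.ofReal_re]
  ring

/-- A positive definite kernel is a Gram kernel. -/
theorem IsPosDefKernel.exists_gram {X : Type u} {Phi : X → X → ℝ} (h : IsPosDefKernel Phi) :
    ∃ (H : Type u) (_ : NormedAddCommGroup H) (_ : InnerProductSpace ℝ H) (_ : CompleteSpace H)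
      (v : X → H), ∀ x y, ⟪v x, v y⟫_ℝ = Phi x y := by
  let B : (X →₀ ℝ) →ₗ[ℝ] (X →₀ ℝ) →ₗ[ℝ] ℝ :=
    Finsupp.linearCombination ℝ (fun x => Finsupp.linearCombination ℝ (fun y => Phi x y))
  have hB : ∀ a b : X →₀ ℝ, B a b = ∑ x ∈ a.support, ∑ y ∈ b.support, a x * (b y * Phi x y) := by
    intro a b
    simp [B, Finsupp.linearCombination_apply, Finsupp.sum, Finset.mul_sum, LinearMap.sum_apply]
  obtain ⟨H, i1, i2, i3, j, -, hj⟩ := exists_hilbert_of_bilin B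
    (fun a b => by
      rw [hB, hB, Finset.sum_comm]
      refine Finset.sum_congr rfl fun x _ => Finset.sum_congr rfl fun y _ => ?_
      rw [h.symm]; ring)
    (fun a => by rw [hB]; exact h.sum_nonneg _ _)
  refine ⟨H, i1, i2, i3, fun x => j (Finsupp.single x 1), fun x y => ?_⟩
  rw [hj]
  simp [B]

/-- Gram kernels of real Hilbert spaces are positive definite. -/
theorem isPosDefKernel_of_gram {X H : Type*} [NormedAddCommGroup H] [InnerProductSpace ℝ H]
    {Phi : X → X → ℝ} (v : X → H) (h : ∀ x y, ⟪v x, v y⟫_ℝ = Phi x y) : IsPosDefKernel Phi := by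
  intro n x a
  have hs : ∀ p q, Phi p q = Phi q p := fun p q => by rw [← h, ← h, real_inner_comm]
  have hre : 0 ≤ (∑ i, ∑ j, (Phi (x i) (x j) : ℂ) * a i * (starRingEnd ℂ) (a j)).re := by
    -- The real and imaginary parts of the coefficients decouple since `Phi` is real and symmetric.
    have key : (∑ i, ∑ j, (Phi (x i) (x j) : ℂ) * a i * (starRingEnd ℂ) (a j)).re =
        ⟪∑ i, (a i).re • v (x i), ∑ i, (a i).re • v (x i)⟫_ℝ +
        ⟪∑ i, (a i).im • v (x i), ∑ i, (a i).im • v (x i)⟫_ℝ := by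
      simp only [sum_inner, inner_sum, inner_smul_left, inner_smul_right, h, Complex.re_sum, Finset.mul_sum,
        ← Finset.sum_add_distrib]
      refine Finset.sum_congr rfl fun i _ => Finset.sum_congr rfl fun j _ => ?_
      rw [hs (x j) (x i)]
      simp [Complex.mul_re]
      ring
    rw [key]
    exact add_nonneg real_inner_self_nonneg real_inner_self_nonneg
  have him : (∑ i, ∑ j, (Phi (x i) (x j) : ℂ) * a i * (starRingEnd ℂ) (a j)).im = 0 := by
    have key : (∑ i, ∑ j, (Phi (x i) (x j) : ℂ) * a i * (starRingEnd ℂ) (a j)).im =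
        ⟪∑ i, (a i).re • v (x i), ∑ i, (a i).im • v (x i)⟫_ℝ -
        ⟪∑ i, (a i).im • v (x i), ∑ i, (a i).re • v (x i)⟫_ℝ := by
      simp only [sum_inner, inner_sum, inner_smul_left, inner_smul_right, h, Complex.im_sum, Finset.mul_sum,
        ← Finset.sum_sub_distrib]
      refine Finset.sum_congr rfl fun i _ => Finset.sum_congr rfl fun j _ => ?_
      rw [hs (x j) (x i)]
      simp [Complex.mul_im]
      ring
    rw [key, real_inner_comm, sub_self]
  exact Complex.le_def.2 ⟨by simpa using hre, by simpa using him.symm⟩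

/-! ### Functions of positive type on `G` -/

section Gram

variable {G : Type u} [Group G]

/-- A function `phi` on `G` for which `(x, y) ↦ phi (x⁻¹ y)` is a Gram kernel of a Hilbert space. -/
def IsGramFunction (phi : G → ℝ) : Prop :=
  ∃ (H : Type u) (_ : NormedAddCommGroup H) (_ : InnerProductSpace ℝ H) (_ : CompleteSpace H)
    (v : G → H), ∀ x y, ⟪v x, v y⟫_ℝ = phi (x⁻¹ * y)

theorem IsGramFunction.inv_apply {phi : G → ℝ} (h : IsGramFunction phi) (x : G) :
    phi x⁻¹ = phi x := by
  obtain ⟨H, _, _, _, v, hv⟩ := h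
  have h1 := hv 1 x
  have h2 := hv x 1
  rw [real_inner_comm, h1] at h2
  simpa using h2.symm

theorem IsGramFunction.abs_le {phi : G → ℝ} (h : IsGramFunction phi) (x : G) :
    |phi x| ≤ phi 1 := by
  obtain ⟨H, _, _, _, v, hv⟩ := h
  have h1 := abs_real_inner_le_norm (v 1) (v x)
  have h2 : ‖v x‖ ^ 2 = phi 1 := by rw [← real_inner_self_eq_norm_sq, hv, inv_mul_cancel]
  have h3 : ‖v 1‖ ^ 2 = phi 1 := by rw [← real_inner_self_eq_norm_sq, hv, inv_mul_cancel]
  have h4 : ‖v 1‖ = ‖v x‖ := by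
    rw [← sq_eq_sq₀ (norm_nonneg _) (norm_nonneg _), h2, h3]
  rw [hv, inv_one, one_mul, h4, ← sq, h2] at h1
  exact h1

theorem IsGramFunction.const_mul {phi : G → ℝ} (h : IsGramFunction phi) {c : ℝ} (hc : 0 ≤ c) :
    IsGramFunction fun x => c * phi x := by
  obtain ⟨H, i1, i2, i3, v, hv⟩ := h
  refine ⟨H, i1, i2, i3, fun x => √c • v x, fun x y => ?_⟩
  rw [real_inner_smul_left, real_inner_smul_right, hv, ← mul_assoc, Real.mul_self_sqrt hc]

end Gram

/-! ### Translations on `L¹(G)` -/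

section Translation

variable {G : Type u} [Group G] [TopologicalSpace G] [IsTopologicalGroup G]
    [MeasurableSpace G] [BorelSpace G] (lam : Measure G) [lam.IsHaarMeasure]

/-- Translation `F ↦ (t ↦ F (x * t))` on `L¹(G)`. -/
noncomputable def translateL1 (x : G) : Lp ℝ 1 lam →ₗ[ℝ] Lp ℝ 1 lam where
  toFun F := DomMulAct.mk x • F
  map_add' F h := smul_add _ F h
  map_smul' r F := smul_comm _ r F

theorem translateL1_ae (x : G) (F : Lp ℝ 1 lam) :
    translateL1 lam x F =ᵐ[lam] fun t => F (x * t) :=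
  DomMulAct.smul_Lp_ae_eq (DomMulAct.mk x) F

theorem translateL1_translateL1 (x s : G) (F : Lp ℝ 1 lam) :
    translateL1 lam s (translateL1 lam x F) = translateL1 lam (x * s) F := by
  change DomMulAct.mk s • DomMulAct.mk x • F = DomMulAct.mk (x * s) • F
  rw [smul_smul, ← DomMulAct.mk_mul]

theorem translateL1_one (F : Lp ℝ 1 lam) : translateL1 lam 1 F = F := by
  change DomMulAct.mk (1 : G) • F = F
  rw [DomMulAct.mk_one, one_smul]

theorem norm_translateL1 (x : G) (F : Lp ℝ 1 lam) : ‖translateL1 lam x F‖ = ‖F‖ :=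
  DomMulAct.norm_smul_Lp (DomMulAct.mk x) F

end Translation

theorem integrableOn_of_continuous_of_abs_le {X : Type*} [TopologicalSpace X] [MeasurableSpace X]
    [BorelSpace X] {lam : Measure X} {f : X → ℝ} (hf : Continuous f) {C : ℝ}
    (hb : ∀ x, |f x| ≤ C) {s : Set X} (hs : lam s < ∞) : IntegrableOn f s lam := by
  have : IsFiniteMeasure (lam.restrict s) := ⟨by simpa using hs⟩
  exact Integrable.of_bound hf.aestronglyMeasurable C (Eventually.of_forall hb)

/-! ### Functionals of positive type and weak-* limits -/

section WeakLimit

variable {G : Type u} [Group G] [TopologicalSpace G] [IsTopologicalGroup G]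
    [LocallyCompactSpace G] [T2Space G] [MeasurableSpace G] [BorelSpace G]
    (lam : Measure G) [lam.IsHaarMeasure] [lam.Regular]

/-- By inner regularity `s` is a countable union of compact sets up to a null set, and a continuous
function has separable range on each of them. -/
theorem aestronglyMeasurable_restrict_of_continuous {E : Type*} [NormedAddCommGroup E]
    {g : G → E} (hg : Continuous g) {s : Set G} (hs : MeasurableSet s) (hfin : lam s ≠ ∞) :
    AEStronglyMeasurable g (lam.restrict s) := by
  have h1 : ∀ n : ℕ, ∃ k, k ⊆ s ∧ IsCompact k ∧ lam (s \ k) < ((n : ℝ≥0∞) + 1)⁻¹ := fun n =>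
    hs.exists_isCompact_sdiff_lt hfin (by simp)
  choose k hks hk hlt using h1
  have h2 : lam (s \ ⋃ n, k n) = 0 := by
    refine le_antisymm (ge_of_tendsto' (x := atTop) (f := fun n : ℕ => ((n : ℝ≥0∞) + 1)⁻¹) ?_
      fun n => ?_) bot_le
    · simpa using (tendsto_add_atTop_iff_nat 1).2 ENNReal.tendsto_inv_nat_nhds_zero
    · exact (measure_mono (Set.sdiff_subset_sdiff_right (Set.subset_iUnion k n))).trans (hlt n).le
  have h3 : lam.restrict s = lam.restrict (⋃ n, k n) := by
    refine Measure.restrict_congr_set ?_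
    refine (ae_le_set.2 h2).antisymm (LE.le.eventuallyLE (Set.iUnion_subset hks))
  rw [h3, aestronglyMeasurable_iUnion_iff]
  exact fun n => hg.continuousOn.aestronglyMeasurable_of_isCompact (hk n) (hk n).measurableSet

/-- The product of an integrable function with a bounded continuous function is integrable. No
countability assumption on the space or on the target is made. -/
theorem integrable_smul_of_continuous {lam : Measure G} [lam.IsHaarMeasure] [lam.Regular]
    {E : Type*} [NormedAddCommGroup E] [NormedSpace ℝ E]
    {F : G → ℝ} (hF : Integrable F lam) {g : G → E} (hg : Continuous g) {C : ℝ}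
    (hC : ∀ x, ‖g x‖ ≤ C) : Integrable (fun x => F x • g x) lam := by
  have key : AEStronglyMeasurable (fun x => F x • g x) lam := by
    let f := hF.1.mk F
    have hf : StronglyMeasurable f := hF.1.stronglyMeasurable_mk
    have hFf : F =ᵐ[lam] f := hF.1.ae_eq_mk
    have hfi : Integrable f lam := hF.congr hFf
    -- The sets `s n` have finite measure, and `f` vanishes off their union, so `g` only matters
    -- there.
    let s : ℕ → Set G := fun n => {x | 1 / ((n : ℝ) + 1) ≤ ‖f x‖}
    have hs : ∀ n, MeasurableSet (s n) := fun n =>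
      measurableSet_le measurable_const hf.norm.measurable
    have h1 : AEStronglyMeasurable g (lam.restrict (⋃ n, s n)) := by
      rw [aestronglyMeasurable_iUnion_iff]
      exact fun n => aestronglyMeasurable_restrict_of_continuous lam hg (hs n)
        (hfi.measure_norm_ge_lt_top Nat.one_div_pos_of_nat).ne
    have h2 := (aestronglyMeasurable_indicator_iff (MeasurableSet.iUnion hs)).2
      (hf.aestronglyMeasurable.smul h1)
    refine h2.congr ?_
    filter_upwards [hFf] with x hx
    by_cases hxs : x ∈ ⋃ n, s n
    · rw [Set.indicator_of_mem hxs, hx]; rfl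
    · have hx0 : f x = 0 := by
        by_contra h0
        obtain ⟨n, hn⟩ := exists_nat_one_div_lt (norm_pos_iff.2 h0)
        exact hxs (Set.mem_iUnion.2 ⟨n, hn.le⟩)
      rw [Set.indicator_of_notMem hxs, hx, hx0, zero_smul]
  refine (hF.norm.mul_const C).mono' key (Eventually.of_forall fun x => ?_)
  rw [norm_smul]
  exact mul_le_mul_of_nonneg_left (hC x) (norm_nonneg _)

theorem integrable_mul_of_continuous {lam : Measure G} [lam.IsHaarMeasure] [lam.Regular]
    {F : G → ℝ} (hF : Integrable F lam) {g : G → ℝ} (hg : Continuous g) {C : ℝ}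
    (hC : ∀ x, |g x| ≤ C) : Integrable (fun x => F x * g x) lam :=
  integrable_smul_of_continuous hF hg hC

theorem continuous_translateL1 (F : Lp ℝ 1 lam) : Continuous fun x => translateL1 lam x F := by
  have : Fact ((1 : ℝ≥0∞) ≠ ∞) := ⟨ENNReal.one_ne_top⟩
  have : Continuous fun x : G => DomMulAct.mk x • F :=
    (DomMulAct.continuous_mk).smul continuous_const
  exact this

variable {lam}

/-- The form `(F, h) ↦ ∫ F(x) Λ(h(x ·)) dx` on `L¹(G)` attached to a functional `Λ`. -/
noncomputable def functionalForm (L : Lp ℝ 1 lam →L[ℝ] ℝ) (F h : Lp ℝ 1 lam) : ℝ :=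
  ∫ x, F x * L (translateL1 lam x h) ∂lam

theorem integrable_functionalForm (L : Lp ℝ 1 lam →L[ℝ] ℝ) (F h : Lp ℝ 1 lam) :
    Integrable (fun x => F x * L (translateL1 lam x h)) lam := by
  refine integrable_smul_of_continuous (L1.integrable_coeFn F)
    (L.continuous.comp (continuous_translateL1 lam h)) (C := ‖L‖ * ‖h‖) fun x => ?_
  rw [← norm_translateL1 lam x h]
  exact L.le_opNorm _

/-- The form as a value of the functional. -/
theorem functionalForm_eq (L : Lp ℝ 1 lam →L[ℝ] ℝ) (F h : Lp ℝ 1 lam) :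
    functionalForm L F h = L (∫ x, F x • translateL1 lam x h ∂lam) := by
  rw [← L.integral_comp_comm (integrable_smul_of_continuous (L1.integrable_coeFn F)
    (continuous_translateL1 lam h) (C := ‖h‖) fun x => (norm_translateL1 lam x h).le)]
  simp [functionalForm]

theorem functionalForm_translateL1 (L : Lp ℝ 1 lam →L[ℝ] ℝ) (x : G) (F h : Lp ℝ 1 lam) :
    functionalForm L (translateL1 lam x F) (translateL1 lam x h) = functionalForm L F h := by
  unfold functionalForm
  rw [← integral_mul_left_eq_self (fun s => F s * L (translateL1 lam s h)) x]
  refine integral_congr_ae ?_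
  filter_upwards [translateL1_ae lam x F] with s hs
  rw [hs, translateL1_translateL1]

/-- `functionalForm` as a bilinear map. -/
noncomputable def functionalBilin (L : Lp ℝ 1 lam →L[ℝ] ℝ) :
    Lp ℝ 1 lam →ₗ[ℝ] Lp ℝ 1 lam →ₗ[ℝ] ℝ :=
  LinearMap.mk₂ ℝ (functionalForm L)
    (fun F F' h => by
      unfold functionalForm
      rw [← integral_add (integrable_functionalForm L F h) (integrable_functionalForm L F' h)]
      refine integral_congr_ae ?_
      filter_upwards [Lp.coeFn_add F F'] with x hx
      rw [hx, Pi.add_apply, add_mul])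
    (fun r F h => by
      unfold functionalForm
      rw [smul_eq_mul, ← integral_const_mul]
      refine integral_congr_ae ?_
      filter_upwards [Lp.coeFn_smul r F] with x hx
      rw [hx, Pi.smul_apply, smul_eq_mul, mul_assoc])
    (fun F h h' => by
      unfold functionalForm
      rw [← integral_add (integrable_functionalForm L F h) (integrable_functionalForm L F h')]
      simp only [map_add, mul_add])
    (fun r F h => by
      unfold functionalForm
      rw [smul_eq_mul, ← integral_const_mul]
      simp only [map_smul, smul_eq_mul, mul_left_comm])

/-- A functional on `L¹(G)` that is of positive type is integration against a continuous function
of positive type. -/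
theorem exists_function_of_functional (L : Lp ℝ 1 lam →L[ℝ] ℝ)
    (hsymm : ∀ F h, functionalForm L F h = functionalForm L h F)
    (hle : ∀ F, L F ^ 2 ≤ functionalForm L F F) :
    ∃ phi : G → ℝ, Continuous phi ∧ IsGramFunction phi ∧ phi 1 ≤ 1 ∧
      ∀ F, L F = ∫ x, F x * phi x ∂lam := by
  -- GNS construction: translations act isometrically on `H`, and `hle` makes `L` a contraction for
  -- the new norm.
  obtain ⟨H, i1, i2, i3, j, hj, hB⟩ := exists_hilbert_of_bilin (functionalBilin L) hsymm
    (fun F => (sq_nonneg _).trans (hle F))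
  replace hB : ∀ F h, ⟪j F, j h⟫_ℝ = functionalForm L F h := hB
  have hnorm : ∀ x F, ‖j (translateL1 lam x F)‖ = ‖j F‖ := fun x F => by
    rw [← sq_eq_sq₀ (norm_nonneg _) (norm_nonneg _), ← real_inner_self_eq_norm_sq,
      ← real_inner_self_eq_norm_sq, hB, hB, functionalForm_translateL1]
  have hLj : ∀ F, |L F| ≤ ‖j F‖ := fun F => by
    rw [← sq_le_sq₀ (abs_nonneg _) (norm_nonneg _), sq_abs, ← real_inner_self_eq_norm_sq, hB]
    exact hle F
  -- The functional `F ↦ L (translateL1 lam x F)` is bounded by `‖j F‖`, so it extends to `H` and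
  -- Riesz gives the vector `v x`.
  have hv : ∀ x, ∃ w : H, ∀ F, ⟪w, j F⟫_ℝ = L (translateL1 lam x F) := fun x =>
    ⟨(InnerProductSpace.toDual ℝ H).symm
      ((L.toLinearMap.comp (translateL1 lam x)).extendOfNorm j), fun F => by
        rw [InnerProductSpace.toDual_symm_apply, LinearMap.extendOfNorm_eq hj ⟨1, fun F => ?_⟩]
        · rfl
        · rw [one_mul, ← hnorm x]
          exact hLj _⟩
  choose v hv using hv
  have hle1 : ∀ x, ‖v x‖ ≤ 1 := fun x =>
    norm_le_of_denseRange_inner hj zero_le_one fun F => by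
      rw [hv, one_mul, ← hnorm x]
      exact (le_abs_self _).trans (hLj _)
  -- Pairing `v (g * x)` with `j F` is pairing `v x` with the translate of `F`, which has the same
  -- norm. The cases `c = 0, 1` suffice for polarisation in `hinner`.
  have hinv : ∀ (g x y : G) (c : ℝ), ‖v (g * x) + c • v (g * y)‖ ≤ ‖v x + c • v y‖ := by
    intro g x y c
    refine norm_le_of_denseRange_inner hj (norm_nonneg _) fun F => ?_
    have : ⟪v (g * x) + c • v (g * y), j F⟫_ℝ = ⟪v x + c • v y, j (translateL1 lam g F)⟫_ℝ := by
      simp only [inner_add_left, inner_smul_left, hv, translateL1_translateL1]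
    rw [this, ← hnorm g F]
    exact real_inner_le_norm _ _
  have hinv' : ∀ (g x y : G) (c : ℝ), ‖v (g * x) + c • v (g * y)‖ = ‖v x + c • v y‖ := by
    intro g x y c
    refine (hinv g x y c).antisymm ?_
    simpa using hinv g⁻¹ (g * x) (g * y) c
  have hinner : ∀ g x y : G, ⟪v (g * x), v (g * y)⟫_ℝ = ⟪v x, v y⟫_ℝ := by
    intro g x y
    have h1 := hinv' g x y 1
    have h2 := hinv' g x y 0
    have h3 := hinv' g y x 0
    simp only [one_smul, zero_smul, add_zero] at h1 h2 h3
    rw [real_inner_eq_norm_add_mul_self_sub_norm_mul_self_sub_norm_mul_self_div_two,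
      real_inner_eq_norm_add_mul_self_sub_norm_mul_self_sub_norm_mul_self_div_two, h1, h2, h3]
  -- Weak continuity is clear against `j F`; since `‖v x‖ ≤ 1`, approximating `w` by such vectors is
  -- uniform in `x`.
  have hcont : ∀ w : H, Continuous fun x => ⟪w, v x⟫_ℝ := by
    intro w
    rw [continuous_iff_continuousAt]
    intro x
    rw [ContinuousAt, Metric.tendsto_nhds]
    intro ε hε
    obtain ⟨F, hF⟩ := hj.exists_dist_lt w (show 0 < ε / 3 by linarith)
    have hc : Continuous fun y => ⟪j F, v y⟫_ℝ := by
      simp only [real_inner_comm, hv]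
      exact L.continuous.comp (continuous_translateL1 lam F)
    filter_upwards [Metric.tendsto_nhds.1 hc.continuousAt (ε / 3) (by linarith)] with y hy
    have hd : ∀ z, |⟪w, v z⟫_ℝ - ⟪j F, v z⟫_ℝ| < ε / 3 := fun z => by
      rw [← inner_sub_left]
      refine (abs_real_inner_le_norm _ _).trans_lt ?_
      rw [← dist_eq_norm]
      nlinarith [hle1 z, norm_nonneg (v z), dist_nonneg (x := w) (y := j F)]
    have h1 := abs_lt.1 (hd x)
    have h2 := abs_lt.1 (hd y)
    rw [Real.dist_eq] at hy ⊢
    have h3 := abs_lt.1 hy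
    exact abs_lt.2 ⟨by linarith, by linarith⟩
  have hint : ∀ (w : H) (F : Lp ℝ 1 lam), Integrable (fun x => F x * ⟪w, v x⟫_ℝ) lam :=
    fun w F => integrable_smul_of_continuous (L1.integrable_coeFn F) (hcont w) (C := ‖w‖) fun x =>
      (abs_real_inner_le_norm _ _).trans (mul_le_of_le_one_right (norm_nonneg _) (hle1 x))
  -- Both sides are continuous in `w`, and for `w = j h` this is the symmetry of the form. Taking `w
  -- = v 1` represents `L`.
  have hrep : ∀ (w : H) F, ⟪w, j F⟫_ℝ = ∫ x, F x * ⟪w, v x⟫_ℝ ∂lam := by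
    intro w F
    let T : H →ₗ[ℝ] ℝ :=
      { toFun := fun w => ∫ x, F x * ⟪w, v x⟫_ℝ ∂lam
        map_add' := fun w w' => by
          rw [← integral_add (hint w F) (hint w' F)]
          simp only [inner_add_left, mul_add]
        map_smul' := fun r w => by
          rw [RingHom.id_apply, smul_eq_mul, ← integral_const_mul]
          simp only [real_inner_smul_left, mul_left_comm] }
    have hT : Continuous T := by
      refine AddMonoidHomClass.continuous_of_bound T (∫ x, ‖F x‖ ∂lam) fun w => ?_
      rw [← integral_mul_const]
      refine norm_integral_le_of_norm_le ((L1.integrable_coeFn F).norm.mul_const _)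
        (Eventually.of_forall fun x => ?_)
      rw [norm_mul]
      exact mul_le_mul_of_nonneg_left ((abs_real_inner_le_norm _ _).trans
        (mul_le_of_le_one_right (norm_nonneg _) (hle1 x))) (norm_nonneg _)
    refine hj.induction_on (p := fun w => ⟪w, j F⟫_ℝ = T w) w
      (isClosed_eq (by fun_prop) hT) fun h => ?_
    rw [hB, hsymm]
    refine integral_congr_ae (Eventually.of_forall fun x => ?_)
    simp only [← hv, real_inner_comm]
  refine ⟨fun x => ⟪v 1, v x⟫_ℝ, hcont _, ⟨H, i1, i2, i3, v, fun x y => ?_⟩, ?_, fun F => ?_⟩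
  · have := hinner x⁻¹ x y
    rw [inv_mul_cancel] at this
    exact this.symm
  · have := hle1 1
    change ⟪v 1, v 1⟫_ℝ ≤ 1
    rw [real_inner_self_eq_norm_sq]
    exact pow_le_one₀ (norm_nonneg _) this
  · rw [← hrep, hv, translateL1_one]

/-- Integration against a continuous function bounded by `1`, as a functional on `L¹(G)`. -/
noncomputable def pairing (lam : Measure G) [lam.IsHaarMeasure] [lam.Regular] {phi : G → ℝ}
    (hc : Continuous phi) (hb : ∀ x, |phi x| ≤ 1) : Lp ℝ 1 lam →L[ℝ] ℝ :=
  LinearMap.mkContinuous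
    { toFun := fun F => ∫ x, F x * phi x ∂lam
      map_add' := fun F h => by
        rw [← integral_add (integrable_mul_of_continuous (L1.integrable_coeFn F) hc hb)
          (integrable_mul_of_continuous (L1.integrable_coeFn h) hc hb)]
        refine integral_congr_ae ?_
        filter_upwards [Lp.coeFn_add F h] with x hx
        rw [hx, Pi.add_apply, add_mul]
      map_smul' := fun r F => by
        rw [RingHom.id_apply, smul_eq_mul, ← integral_const_mul]
        refine integral_congr_ae ?_
        filter_upwards [Lp.coeFn_smul r F] with x hx
        rw [hx, Pi.smul_apply, smul_eq_mul, mul_assoc] } 1 fun F => by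
    rw [one_mul, L1.norm_eq_integral_norm]
    refine norm_integral_le_of_norm_le (L1.integrable_coeFn F).norm
      (Eventually.of_forall fun x => ?_)
    rw [norm_mul]
    exact mul_le_of_le_one_right (norm_nonneg _) (hb x)

theorem pairing_apply {phi : G → ℝ} (hc : Continuous phi) (hb : ∀ x, |phi x| ≤ 1)
    (F : Lp ℝ 1 lam) : pairing lam hc hb F = ∫ x, F x * phi x ∂lam := rfl

theorem norm_pairing_le {phi : G → ℝ} (hc : Continuous phi) (hb : ∀ x, |phi x| ≤ 1) :
    ‖pairing lam hc hb‖ ≤ 1 :=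
  LinearMap.mkContinuous_norm_le _ zero_le_one _

theorem pairing_translateL1 {phi : G → ℝ} (hc : Continuous phi) (hb : ∀ x, |phi x| ≤ 1)
    (g : G) (F : Lp ℝ 1 lam) :
    pairing lam hc hb (translateL1 lam g F) = ∫ x, F x * phi (g⁻¹ * x) ∂lam := by
  rw [pairing_apply, ← integral_mul_left_eq_self (fun x => F x * phi (g⁻¹ * x)) g]
  refine integral_congr_ae ?_
  filter_upwards [translateL1_ae lam g F] with x hx
  rw [hx, inv_mul_cancel_left]

/-- The form attached to integration against a function of positive type is a Gram form. -/
theorem IsGramFunction.exists_functionalForm_eq {phi : G → ℝ} (h : IsGramFunction phi)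
    (hc : Continuous phi) (h1 : phi 1 = 1) (hb : ∀ x, |phi x| ≤ 1) :
    ∃ (H : Type u) (_ : NormedAddCommGroup H) (_ : InnerProductSpace ℝ H)
      (w : Lp ℝ 1 lam → H) (e : H), ‖e‖ = 1 ∧ (∀ F, pairing lam hc hb F = ⟪e, w F⟫_ℝ) ∧
      ∀ F h, functionalForm (pairing lam hc hb) F h = ⟪w F, w h⟫_ℝ := by
  obtain ⟨H, i1, i2, i3, v, hv⟩ := h
  have hv1 : ∀ x, ‖v x‖ = 1 := fun x => by
    have := real_inner_self_eq_norm_sq (v x)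
    rw [hv, inv_mul_cancel, h1] at this
    exact (pow_eq_one_iff_of_nonneg (norm_nonneg _) two_ne_zero).1 this.symm
  have hvc : Continuous v := by
    rw [continuous_iff_continuousAt]
    intro x
    rw [ContinuousAt, tendsto_iff_norm_sub_tendsto_zero]
    -- The Gram identity makes `v` norm continuous, so that vector-valued integrals against it
    -- exist.
    have h2 : ∀ y, ‖v y - v x‖ = √(2 - 2 * phi (y⁻¹ * x)) := fun y => by
      rw [← Real.sqrt_sq (norm_nonneg (v y - v x)), norm_sub_sq_real, hv, hv1, hv1]
      ring_nf
    simp only [h2]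
    have h3 : Continuous fun y => √(2 - 2 * phi (y⁻¹ * x)) := by fun_prop
    have := h3.tendsto x
    simpa [h1] using this
  have hint : ∀ F : Lp ℝ 1 lam, Integrable (fun x => F x • v x) lam := fun F =>
    integrable_smul_of_continuous (L1.integrable_coeFn F) hvc fun x => (hv1 x).le
  have hin : ∀ (u : H) (F : Lp ℝ 1 lam),
      ⟪u, ∫ x, F x • v x ∂lam⟫_ℝ = ∫ x, F x * ⟪u, v x⟫_ℝ ∂lam := fun u F => by
    rw [← integral_inner (hint F)]
    simp only [real_inner_smul_right]
  refine ⟨H, i1, i2, fun F => ∫ x, F x • v x ∂lam, v 1, hv1 1, fun F => ?_, fun F h => ?_⟩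
  · rw [hin, pairing_apply]
    simp [hv]
  · rw [real_inner_comm, hin, functionalForm]
    simp only [pairing_translateL1]
    simp only [← hv, ← hin, real_inner_comm]

/-- Weak-* sequential compactness, along an ultrafilter, of the continuous normalised functions of
positive type, if the limit is allowed to have a smaller value at the identity. -/
theorem exists_weak_limit (lam : Measure G) [lam.IsHaarMeasure] [lam.Regular]
    (phi : ℕ → G → ℝ) (hg : ∀ n, IsGramFunction (phi n))
    (hc : ∀ n, Continuous (phi n)) (h1 : ∀ n, phi n 1 = 1) :
    ∃ psi : G → ℝ, Continuous psi ∧ IsGramFunction psi ∧ psi 1 ≤ 1 ∧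
      ∀ F : G → ℝ, Integrable F lam → Tendsto (fun n => ∫ x, F x * phi n x ∂lam)
        (hyperfilter ℕ) (𝓝 (∫ x, F x * psi x ∂lam)) := by
  have hb : ∀ n x, |phi n x| ≤ 1 := fun n x => (h1 n) ▸ (hg n).abs_le x
  -- Compactness is used in the dual of `L¹(G)` itself: `lam` need not be σ-finite, and the limit is
  -- identified with a function only afterwards.
  let L : ℕ → WeakDual ℝ (Lp ℝ 1 lam) := fun n =>
    StrongDual.toWeakDual (pairing lam (hc n) (hb n))
  have hmem : ∀ n, L n ∈ WeakDual.toStrongDual ⁻¹' Metric.closedBall 0 1 := fun n => by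
    simpa [L] using norm_pairing_le (lam := lam) (hc n) (hb n)
  obtain ⟨M, -, hM⟩ :=
    (WeakDual.isCompact_closedBall (𝕜 := ℝ) (E := Lp ℝ 1 lam) 0 1).ultrafilter_le_nhds
      ((hyperfilter ℕ).map L) (tendsto_principal.2 (Eventually.of_forall hmem))
  have hlim : ∀ F, Tendsto (fun n => pairing lam (hc n) (hb n) F) (hyperfilter ℕ) (𝓝 (M F)) :=
    fun F => ((WeakDual.eval_continuous F).tendsto M).comp hM
  let M' : Lp ℝ 1 lam →L[ℝ] ℝ := WeakDual.toStrongDual M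
  have hform : ∀ F h, Tendsto (fun n => functionalForm (pairing lam (hc n) (hb n)) F h)
      (hyperfilter ℕ) (𝓝 (functionalForm M' F h)) := fun F h => by
    -- The form is the functional at a fixed element of `L¹(G)`, so weak-* convergence applies.
    simp only [functionalForm_eq]
    exact hlim _
  obtain ⟨psi, hpc, hpg, hp1, hp⟩ := exists_function_of_functional M'
    (fun F h => tendsto_nhds_unique (hform F h) (by
      refine (hform h F).congr fun n => ?_
      obtain ⟨H, _, _, w, e, -, -, he⟩ :=
        (hg n).exists_functionalForm_eq (lam := lam) (hc n) (h1 n) (hb n)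
      rw [he, he, real_inner_comm]))
    -- For each `n` this is Cauchy–Schwarz with the unit vector `e`.
    (fun F => le_of_tendsto_of_tendsto' ((hlim F).pow 2) (hform F F) fun n => by
      obtain ⟨H, _, _, w, e, h1, he1, he⟩ :=
        (hg n).exists_functionalForm_eq (lam := lam) (hc n) (h1 n) (hb n)
      rw [he, he1, real_inner_self_eq_norm_sq, ← sq_abs]
      have := abs_real_inner_le_norm e (w F)
      rw [h1, one_mul] at this
      gcongr)
  refine ⟨psi, hpc, hpg, hp1, fun F hF => ?_⟩
  have hcongr : ∀ chi : G → ℝ, ∫ x, hF.toL1 F x * chi x ∂lam = ∫ x, F x * chi x ∂lam := fun chi =>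
    integral_congr_ae (by filter_upwards [hF.coeFn_toL1] with x hx; rw [hx])
  have h2 := hlim (hF.toL1 F)
  have h3 : M (hF.toL1 F) = ∫ x, F x * psi x ∂lam := (hp _).trans (hcongr psi)
  rw [h3] at h2
  exact h2.congr fun n => hcongr (phi n)

end WeakLimit

/-! ### The extremal problem on `G` -/

section Extremal

variable {G : Type u} [Group G] [TopologicalSpace G] [IsTopologicalGroup G]
    [LocallyCompactSpace G] [T2Space G] [MeasurableSpace G] [BorelSpace G]
    {lam : Measure G} [lam.IsHaarMeasure] [lam.Regular]

/-- The functions `g ↦ Phi(K, gK)` on `G` that belong to admissible kernels `Phi`. -/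
structure IsAdmissibleFunction (K : Subgroup G) (U V : Set G) (phi : G → ℝ) : Prop where
  continuous : Continuous phi
  gram : IsGramFunction phi
  map_one : phi 1 = 1
  left_inv : ∀ k ∈ K, ∀ g, phi (k * g) = phi g
  nonpos : ∀ g ∉ U, phi g ≤ 0
  nonneg : ∀ g ∉ V, 0 ≤ phi g

theorem IsAdmissibleFunction.abs_le {K : Subgroup G} {U V : Set G} {phi : G → ℝ}
    (h : IsAdmissibleFunction K U V phi) (x : G) : |phi x| ≤ 1 :=
  h.map_one ▸ h.gram.abs_le x

/-- Passes from weak limits, which only control integrals, to pointwise signs: a positive value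
would persist on a compact neighbourhood, which has positive Haar measure. -/
theorem nonpos_of_setIntegral_isCompact_nonpos {f : G → ℝ} (hf : Continuous f) {O : Set G}
    (hO : IsOpen O) (h : ∀ C ⊆ O, IsCompact C → ∫ x in C, f x ∂lam ≤ 0) :
    ∀ x ∈ O, f x ≤ 0 := by
  intro x hx
  by_contra! hpos
  have hW : O ∩ {y | 0 < f y} ∈ 𝓝 x :=
    (hO.inter (isOpen_lt continuous_const hf)).mem_nhds ⟨hx, hpos⟩
  obtain ⟨C, hCx, hCW, hC⟩ := local_compact_nhds hW
  have h1 := h C (fun y hy => (hCW hy).1) hC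
  have h2 : 0 < ∫ y in C, f y ∂lam := by
    rw [setIntegral_pos_iff_support_of_nonneg_ae
      (ae_restrict_of_forall_mem hC.measurableSet fun y hy => (hCW hy).2.le)
      (hf.continuousOn.integrableOn_compact hC)]
    have : Function.support f ∩ C = C :=
      Set.inter_eq_right.2 fun y hy => (hCW hy).2.ne'
    rw [this]
    exact Measure.measure_pos_of_mem_nhds lam hCx
  linarith

/-- The open sets where `f > 1/(m+1)` exhaust the part of `O` that matters. A Markov bound on
compact subsets, with inner regularity, shows that they have finite measure, so `O` need not be
σ-finite. -/
theorem setLIntegral_le_of_setIntegral_le {f : G → ℝ} (hf : Continuous f) {C : ℝ}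
    (hb : ∀ x, |f x| ≤ C) {O : Set G} (hO : IsOpen O) (hf0 : ∀ x ∈ O, 0 ≤ f x) {R : ℝ}
    (h : ∀ D ⊆ O, MeasurableSet D → lam D < ∞ → ∫ x in D, f x ∂lam ≤ R) :
    ∫⁻ x in O, ENNReal.ofReal (f x) ∂lam ≤ ENNReal.ofReal R := by
  let D : ℕ → Set G := fun m => O ∩ {x | 1 / ((m : ℝ) + 1) < f x}
  have hDo : ∀ m, IsOpen (D m) := fun m => hO.inter (isOpen_lt continuous_const hf)
  have hDmono : Monotone D := fun m n hmn x hx =>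
    ⟨hx.1, lt_of_le_of_lt (Nat.one_div_le_one_div hmn) (Set.mem_ofPred.1 hx.2)⟩
  have hDfin : ∀ m, lam (D m) < ∞ := by
    intro m
    refine lt_of_le_of_lt ?_ (ENNReal.ofReal_lt_top (r := R * (m + 1)))
    rw [(hDo m).measure_eq_iSup_isCompact]
    refine iSup₂_le fun c hc => iSup_le fun hcc => ?_
    have h1 := h c (fun x hx => (hc hx).1) hcc.measurableSet hcc.measure_lt_top
    have h2 : (1 / ((m : ℝ) + 1)) * lam.real c ≤ ∫ x in c, f x ∂lam :=
      setIntegral_ge_of_const_le_real hcc.measurableSet hcc.measure_lt_top.ne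
        (fun x hx => (hc hx).2.le) (hf.continuousOn.integrableOn_compact hcc)
    have h3 : lam.real c ≤ R * (m + 1) := by
      have h4 := h2.trans h1
      rw [one_div, inv_mul_le_iff₀ (by positivity)] at h4
      linarith
    rw [← ENNReal.ofReal_toReal hcc.measure_lt_top.ne]
    exact ENNReal.ofReal_le_ofReal h3
  have hunion : ∫⁻ x in O, ENNReal.ofReal (f x) ∂lam =
      ∫⁻ x in ⋃ m, D m, ENNReal.ofReal (f x) ∂lam := by
    have hDm : MeasurableSet (⋃ m, D m) := MeasurableSet.iUnion fun m => (hDo m).measurableSet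
    rw [← lintegral_indicator hO.measurableSet, ← lintegral_indicator hDm]
    congr 1
    ext x
    by_cases hxD : x ∈ ⋃ m, D m
    · rw [Set.indicator_of_mem hxD, Set.indicator_of_mem]
      obtain ⟨m, hm⟩ := Set.mem_iUnion.1 hxD
      exact hm.1
    · rw [Set.indicator_of_notMem hxD]
      refine Set.indicator_apply_eq_zero.2 fun hxO => ENNReal.ofReal_eq_zero.2 ?_
      by_contra! hpos
      obtain ⟨m, hm⟩ := exists_nat_one_div_lt hpos
      exact hxD (Set.mem_iUnion.2 ⟨m, hxO, hm⟩)
  rw [hunion, setLIntegral_iUnion_of_directed _ hDmono.directed_le]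
  refine iSup_le fun m => ?_
  rw [← ofReal_integral_eq_lintegral_ofReal (integrableOn_of_continuous_of_abs_le hf hb (hDfin m))
    (ae_restrict_of_forall_mem (hDo m).measurableSet fun x hx => hf0 x hx.1)]
  exact ENNReal.ofReal_le_ofReal
    (h _ Set.inter_subset_left (hDo m).measurableSet (hDfin m))

/-- A weak limit of admissible functions satisfies all the conditions but the normalisation. -/
theorem exists_weak_limit_admissible (lam : Measure G) [lam.IsHaarMeasure] [lam.Regular]
    {K : Subgroup G} {U V : Set G} (hU : IsClosed U) (hV : IsClosed V) {phi : ℕ → G → ℝ}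
    (h : ∀ n, IsAdmissibleFunction K U V (phi n)) :
    ∃ psi : G → ℝ, Continuous psi ∧ IsGramFunction psi ∧ psi 1 ≤ 1 ∧
      (∀ k ∈ K, ∀ g, psi (k * g) = psi g) ∧ (∀ g ∉ U, psi g ≤ 0) ∧ (∀ g ∉ V, 0 ≤ psi g) ∧
      ∀ C, MeasurableSet C → lam C < ∞ → Tendsto (fun n => ∫ x in C, phi n x ∂lam)
        (hyperfilter ℕ) (𝓝 (∫ x in C, psi x ∂lam)) := by
  obtain ⟨psi, hc, hg, h1, hlim⟩ := exists_weak_limit lam phi (fun n => (h n).gram)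
    (fun n => (h n).continuous) (fun n => (h n).map_one)
  have hset : ∀ C, MeasurableSet C → lam C < ∞ → Tendsto (fun n => ∫ x in C, phi n x ∂lam)
        (hyperfilter ℕ) (𝓝 (∫ x in C, psi x ∂lam)) := by
    intro C hC hfin
    have h2 := hlim (C.indicator 1)
      ((integrable_indicator_iff hC).2 (integrableOn_const hfin.ne))
    have h3 : ∀ f : G → ℝ, ∫ x, C.indicator 1 x * f x ∂lam = ∫ x in C, f x ∂lam := fun f => by
      rw [← integral_indicator hC]
      refine integral_congr_ae (Eventually.of_forall fun x => ?_)
      by_cases hx : x ∈ C <;> simp [hx]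
    simpa only [h3] using h2
  refine ⟨psi, hc, hg, h1, ?_, ?_, ?_, hset⟩
  -- Translation by `k` moves into the domain of integration, where invariance of each `phi n`
  -- applies. The reverse inequality is the case of `k⁻¹`.
  · have key : ∀ k ∈ K, ∀ g, psi (k * g) ≤ psi g := by
      intro k hk g
      have hkc : Continuous fun x => psi (k * x) := hc.comp (continuous_const_mul k)
      refine sub_nonpos.1 (nonpos_of_setIntegral_isCompact_nonpos (lam := lam) (hkc.sub hc)
        isOpen_univ (fun C _ hC => ?_) g (Set.mem_univ g))
      have himg : ∀ f : G → ℝ,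
          ∫ x in C, f (k * x) ∂lam = ∫ x in (fun x => k⁻¹ * x) ⁻¹' C, f x ∂lam := by
        intro f
        rw [← (measurePreserving_mul_left lam k).setIntegral_preimage_emb
          (measurableEmbedding_mulLeft k) f, ← Set.preimage_comp]
        have : (fun x => k⁻¹ * x) ∘ (fun x => k * x) = id := by ext x; simp
        rw [this, Set.preimage_id]
      have hC' : IsCompact ((fun x => k⁻¹ * x) ⁻¹' C) :=
        (Homeomorph.mulLeft k⁻¹).isCompact_preimage.2 hC
      have e1 := hset _ hC'.measurableSet hC'.measure_lt_top
      have e2 : Tendsto (fun n => ∫ x in C, phi n x ∂lam) (hyperfilter ℕ)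
          (𝓝 (∫ x in C, psi (k * x) ∂lam)) := by
        rw [himg psi]
        refine e1.congr fun n => ?_
        rw [← himg (phi n)]
        simp only [(h n).left_inv k hk]
      have e3 := tendsto_nhds_unique e2 (hset C hC.measurableSet hC.measure_lt_top)
      simp only [Pi.sub_apply]
      rw [integral_sub (hkc.continuousOn.integrableOn_compact hC)
        (hc.continuousOn.integrableOn_compact hC), e3, sub_self]
    intro k hk g
    refine (key k hk g).antisymm ?_
    simpa using key k⁻¹ (K.inv_mem hk) (k * g)
  · refine nonpos_of_setIntegral_isCompact_nonpos (lam := lam) hc hU.isOpen_compl fun C hCU hC => ?_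
    refine le_of_tendsto' (hset C hC.measurableSet hC.measure_lt_top) fun n => ?_
    exact setIntegral_nonpos hC.measurableSet fun x hx => (h n).nonpos x (hCU hx)
  · have := nonpos_of_setIntegral_isCompact_nonpos (lam := lam) hc.neg hV.isOpen_compl
      fun C hCV hC => by
        simp only [Pi.neg_apply]
        rw [integral_neg, neg_nonpos]
        refine ge_of_tendsto' (hset C hC.measurableSet hC.measure_lt_top) fun n => ?_
        exact setIntegral_nonneg hC.measurableSet fun x hx => (h n).nonneg x (hCV hx)
    exact fun g hg => neg_nonpos.1 (this g hg)

/-- Among the integrable admissible functions there is one of maximal integral, provided that there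
is one of positive integral. -/
theorem exists_maximal_admissibleFunction {K : Subgroup G} {U V : Set G} (hU : IsClosed U)
    (hV : IsClosed V) (hfin : lam U < ∞) {phi₀ : G → ℝ} (h₀ : IsAdmissibleFunction K U V phi₀)
    (hi₀ : Integrable phi₀ lam) (hpos : 0 < ∫ x, phi₀ x ∂lam) :
    ∃ psi, IsAdmissibleFunction K U V psi ∧ Integrable psi lam ∧
      ∀ phi, IsAdmissibleFunction K U V phi → Integrable phi lam →
        ∫ x, phi x ∂lam ≤ ∫ x, psi x ∂lam := by
  have hsetle : ∀ phi, IsAdmissibleFunction K U V phi → Integrable phi lam → ∀ C, MeasurableSet C →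
      U ⊆ C → ∫ x, phi x ∂lam ≤ ∫ x in C, phi x ∂lam := by
    intro phi h hi C hC hUC
    rw [← integral_add_compl hC hi]
    have := setIntegral_nonpos (μ := lam) hC.compl
      fun x (hx : x ∈ Cᶜ) => h.nonpos x fun hxU => hx (hUC hxU)
    linarith
  let A : Set ℝ := {r | ∃ phi, IsAdmissibleFunction K U V phi ∧ Integrable phi lam ∧
    ∫ x, phi x ∂lam = r}
  have hAb : BddAbove A := by
    refine ⟨lam.real U, ?_⟩
    rintro _ ⟨phi, h, hi, rfl⟩
    refine (hsetle phi h hi U hU.measurableSet subset_rfl).trans ?_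
    refine (setIntegral_mono_on hi.integrableOn (integrableOn_const hfin.ne (C := (1 : ℝ)))
      hU.measurableSet fun x _ => (le_abs_self _).trans (h.abs_le x)).trans ?_
    simp
  obtain ⟨a, -, ha, haA⟩ := exists_seq_tendsto_sSup (S := A) ⟨_, phi₀, h₀, hi₀, rfl⟩ hAb
  have hS : 0 < sSup A := hpos.trans_le (le_csSup hAb ⟨phi₀, h₀, hi₀, rfl⟩)
  choose phi hphi hint hphia using haA
  obtain ⟨psi, hc, hg, h1, hK, hnp, hnn, hlim⟩ := exists_weak_limit_admissible lam hU hV hphi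
  have hb : ∀ x, |psi x| ≤ 1 := fun x => (hg.abs_le x).trans h1
  -- Upper semicontinuity: dropping the complement of `C` only increases the integral of each `phi
  -- n`.
  have hSC : ∀ C, MeasurableSet C → U ⊆ C → lam C < ∞ → sSup A ≤ ∫ x in C, psi x ∂lam := by
    intro C hC hUC hCf
    refine le_of_tendsto_of_tendsto' (ha.mono_left ?_) (hlim C hC hCf) fun n => ?_
    · rw [← Nat.cofinite_eq_atTop]
      exact hyperfilter_le_cofinite
    · rw [← hphia n]
      exact hsetle _ (hphi n) (hint n) C hC hUC
  have hintU : IntegrableOn psi U lam := integrableOn_of_continuous_of_abs_le hc hb hfin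
  -- Applying `hSC` to `U ∪ D` bounds the negative mass of `psi` on every `D ⊆ Uᶜ` of finite
  -- measure.
  have hR : ∫⁻ x in Uᶜ, ENNReal.ofReal (-psi x) ∂lam ≤
      ENNReal.ofReal (∫ x in U, psi x ∂lam - sSup A) := by
    refine setLIntegral_le_of_setIntegral_le hc.neg (C := 1) (fun x => by simpa using hb x)
      hU.isOpen_compl (fun x hx => neg_nonneg.2 (hnp x hx)) fun D hDU hD hDf => ?_
    have h2 := hSC (U ∪ D) (hU.measurableSet.union hD) Set.subset_union_left
      (measure_union_lt_top hfin hDf)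
    rw [setIntegral_union (Set.disjoint_right.2 hDU) hD hintU
      (integrableOn_of_continuous_of_abs_le hc hb hDf)] at h2
    simp only [Pi.neg_apply]
    rw [integral_neg]
    linarith
  have hR0 : 0 ≤ ∫ x in U, psi x ∂lam - sSup A :=
    sub_nonneg.2 (hSC U hU.measurableSet subset_rfl hfin)
  have hnonneg : 0 ≤ᵐ[lam.restrict Uᶜ] fun x => -psi x :=
    ae_restrict_of_forall_mem hU.measurableSet.compl fun x hx => neg_nonneg.2 (hnp x hx)
  have hintUc : IntegrableOn psi Uᶜ lam := by
    have : IntegrableOn (fun x => -psi x) Uᶜ lam := by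
      refine ⟨hc.neg.aestronglyMeasurable, ?_⟩
      rw [hasFiniteIntegral_iff_ofReal hnonneg]
      exact hR.trans_lt ENNReal.ofReal_lt_top
    simpa using this.neg
  have hintpsi : Integrable psi lam := by
    rw [← integrableOn_univ, ← Set.union_compl_self U]
    exact hintU.union hintUc
  have hSpsi : sSup A ≤ ∫ x, psi x ∂lam := by
    rw [← ofReal_integral_eq_lintegral_ofReal (f := fun x => -psi x) hintUc.neg hnonneg,
      ENNReal.ofReal_le_ofReal_iff hR0, integral_neg] at hR
    rw [← integral_add_compl hU.measurableSet hintpsi]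
    linarith
  -- Otherwise `|psi| ≤ psi 1` forces `psi = 0`, against `0 < sSup A`.
  have hpsi1 : 0 < psi 1 := by
    by_contra! hle
    have hz : ∀ x, psi x = 0 := fun x => abs_nonpos_iff.1 ((hg.abs_le x).trans hle)
    simp only [hz, integral_zero] at hSpsi
    linarith
  refine ⟨fun x => (psi 1)⁻¹ * psi x, ⟨by fun_prop, hg.const_mul (inv_nonneg.2 hpsi1.le),
    inv_mul_cancel₀ hpsi1.ne', fun k hk g => by rw [hK k hk], fun g hgU => ?_, fun g hgV => ?_⟩,
    hintpsi.const_mul _, fun chi hchi hi => ?_⟩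
  · exact mul_nonpos_of_nonneg_of_nonpos (inv_nonneg.2 hpsi1.le) (hnp g hgU)
  · exact mul_nonneg (inv_nonneg.2 hpsi1.le) (hnn g hgV)
  · rw [integral_const_mul]
    calc ∫ x, chi x ∂lam ≤ sSup A := le_csSup hAb ⟨chi, hchi, hi, rfl⟩
      _ ≤ ∫ x, psi x ∂lam := hSpsi
      _ ≤ (psi 1)⁻¹ * ∫ x, psi x ∂lam :=
        le_mul_of_one_le_left (hS.le.trans hSpsi) ((one_le_inv₀ hpsi1).2 h1)

end Extremal

/-! ### A competitor with positive integral -/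

section Existence

open scoped Pointwise

variable {G : Type u} [Group G] [TopologicalSpace G] [IsTopologicalGroup G]
    [LocallyCompactSpace G] [T2Space G] [MeasurableSpace G] [BorelSpace G]
    {lam : Measure G} [lam.IsHaarMeasure] [lam.Regular]

/-- The function `x ↦ λ(A ∩ xA)` is continuous and of positive type. -/
theorem measure_inter_translate {A : Set G} (hA : IsCompact A) :
    Continuous (fun x => lam.real (A ∩ (fun t => x⁻¹ * t) ⁻¹' A)) ∧
      IsGramFunction fun x => lam.real (A ∩ (fun t => x⁻¹ * t) ⁻¹' A) := by
  have : Fact ((2 : ℝ≥0∞) ≠ ∞) := ⟨ENNReal.ofNat_ne_top⟩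
  -- The overlap of two translates of `A` is the inner product of translated indicators in `L²(G)`.
  let a : Lp ℝ 2 lam := indicatorConstLp 2 hA.measurableSet hA.measure_lt_top.ne (1 : ℝ)
  have hin : ∀ x y : G, ⟪DomMulAct.mk x⁻¹ • a, DomMulAct.mk y⁻¹ • a⟫_ℝ =
      lam.real ((fun t => x⁻¹ * t) ⁻¹' A ∩ (fun t => y⁻¹ * t) ⁻¹' A) := fun x y => by
    simp only [a, DomMulAct.mk_smul_indicatorConstLp]
    exact L2.real_inner_indicatorConstLp_one_indicatorConstLp_one _ _ _ _
  have h1 : (fun t : G => (1 : G)⁻¹ * t) ⁻¹' A = A := by simp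
  constructor
  · have h2 : Continuous fun x : G => ⟪DomMulAct.mk (1 : G)⁻¹ • a, DomMulAct.mk x⁻¹ • a⟫_ℝ :=
      continuous_const.inner ((DomMulAct.continuous_mk.comp continuous_inv).smul continuous_const)
    simpa only [hin, h1] using h2
  · refine ⟨Lp ℝ 2 lam, inferInstance, inferInstance, inferInstance,
      fun x => DomMulAct.mk x⁻¹ • a, fun x y => ?_⟩
    change _ = lam.real (A ∩ (fun t => (x⁻¹ * y)⁻¹ * t) ⁻¹' A)
    rw [hin, measureReal_def, measureReal_def, ← measure_preimage_mul lam x, Set.preimage_inter,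
      ← Set.preimage_comp, ← Set.preimage_comp]
    congr 3
    · ext t; simp
    · ext t; simp [mul_assoc]

/-- There is a nonnegative admissible function. -/
theorem exists_nonneg_admissibleFunction (lam : Measure G) [lam.IsHaarMeasure] [lam.Regular]
    {K : Subgroup G} (hK : IsCompact (K : Set G))
    {U V : Set G} (hU : U ∈ 𝓝 (1 : G)) (hUbi : IsBiInvariant K U) :
    ∃ phi : G → ℝ, IsAdmissibleFunction K U V phi ∧ ∀ g, 0 ≤ phi g := by
  have hdiv : Tendsto (fun p : G × G => p.1 * p.2⁻¹) (𝓝 1 ×ˢ 𝓝 1) (𝓝 1) := by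
    have : Continuous fun p : G × G => p.1 * p.2⁻¹ := by fun_prop
    simpa [nhds_prod_eq] using this.tendsto (1, 1)
  obtain ⟨W₀, hW₀, hW₀U⟩ := mem_prod_same_iff.1 (hdiv hU)
  obtain ⟨W, hW1, hWW₀, hW⟩ := local_compact_nhds hW₀
  -- As `W W⁻¹ ⊆ U`, bi-invariance gives `A A⁻¹ ⊆ K U K = U`; the left factor `K` makes the overlap
  -- function `K`-invariant.
  let A : Set G := (K : Set G) * W
  have hA : IsCompact A := hK.mul hW
  have hWA : W ⊆ A := fun w hw => ⟨1, K.one_mem, w, hw, one_mul w⟩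
  have hpos : 0 < lam.real A := by
    rw [measureReal_def]
    exact ENNReal.toReal_pos
      (Measure.measure_pos_of_mem_nhds lam (mem_of_superset hW1 hWA)).ne' hA.measure_lt_top.ne
  have hkA : ∀ k ∈ K, (fun t => k * t) ⁻¹' A = A := by
    have key : ∀ k ∈ K, A ⊆ (fun t => k * t) ⁻¹' A := by
      rintro k hk _ ⟨l, hl, w, hw, rfl⟩
      exact ⟨k * l, K.mul_mem hk hl, w, hw, mul_assoc _ _ _⟩
    intro k hk
    refine Set.Subset.antisymm (fun t ht => ?_) (key k hk)
    simpa using key k⁻¹ (K.inv_mem hk) ht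
  obtain ⟨hc, hg⟩ := measure_inter_translate (lam := lam) hA
  have hnn : ∀ g, 0 ≤ (lam.real A)⁻¹ * lam.real (A ∩ (fun t => g⁻¹ * t) ⁻¹' A) := fun g => by
    positivity
  refine ⟨fun x => (lam.real A)⁻¹ * lam.real (A ∩ (fun t => x⁻¹ * t) ⁻¹' A),
    ⟨continuous_const.mul hc, hg.const_mul (inv_nonneg.2 hpos.le), ?_, ?_, ?_, fun g _ => hnn g⟩,
    hnn⟩
  · simp [hpos.ne']
  · intro k hk g
    congr 1
    rw [measureReal_def, measureReal_def, ← measure_preimage_mul lam k, Set.preimage_inter,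
      hkA k hk, ← Set.preimage_comp]
    congr 3
    ext t
    simp [mul_assoc]
  · intro g hgU
    have : A ∩ (fun t => g⁻¹ * t) ⁻¹' A = ∅ := by
      rw [Set.eq_empty_iff_forall_notMem]
      rintro t ⟨⟨k, hk, w, hw, rfl⟩, ⟨l, hl, z, hz, hlz⟩⟩
      apply hgU
      have hg' : g = k * (w * z⁻¹) * l⁻¹ := by
        have h2 : l * z = g⁻¹ * (k * w) := hlz
        have h3 : g = k * w * (l * z)⁻¹ := by rw [h2]; group
        rw [h3]; group
      rw [hg', hUbi k hk l⁻¹ (K.inv_mem hl)]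
      exact hW₀U (Set.mk_mem_prod (hWW₀ hw) (hWW₀ hz))
    rw [this]
    simp

/-- A nonnegative admissible function has a positive integral. -/
theorem IsAdmissibleFunction.integrable_and_pos {K : Subgroup G} {U V : Set G}
    (hfin : lam U < ∞) {phi : G → ℝ} (h : IsAdmissibleFunction K U V phi) (h0 : ∀ g, 0 ≤ phi g) :
    Integrable phi lam ∧ 0 < ∫ x, phi x ∂lam := by
  have hi : Integrable phi lam := by
    rw [← integrableOn_iff_integrable_of_support_subset (s := U)]
    · exact integrableOn_of_continuous_of_abs_le h.continuous h.abs_le hfin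
    · intro x hx
      by_contra hxU
      exact hx ((h.nonpos x hxU).antisymm (h0 x))
  refine ⟨hi, ?_⟩
  rw [integral_pos_iff_support_of_nonneg h0 hi]
  refine h.continuous.isOpen_support.measure_pos lam ⟨1, ?_⟩
  rw [Function.mem_support, h.map_one]
  exact one_ne_zero

end Existence

/-! ### Integration over `G/K` and over `G` -/

section Quotient

variable {G : Type u} [Group G] [TopologicalSpace G] [IsTopologicalGroup G]
    [LocallyCompactSpace G] [T2Space G] [MeasurableSpace G] [BorelSpace G]
    {lam : Measure G} [lam.IsHaarMeasure] [lam.Regular]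
    {K : Subgroup G} {lamK : Measure K} [IsProbabilityMeasure lamK]
    [MeasurableSpace (G ⧸ K)] [BorelSpace (G ⧸ K)] {mu : Measure (G ⧸ K)}

theorem isProperMap_quotientMk (hK : IsCompact (K : Set G)) :
    IsProperMap ((↑) : G → G ⧸ K) := by
  rw [isProperMap_iff_isClosedMap_and_compact_fibers]
  refine ⟨QuotientGroup.continuous_mk, QuotientGroup.isClosedMap_coe hK, fun y => ?_⟩
  obtain ⟨x, rfl⟩ := QuotientGroup.mk_surjective y
  rw [← Set.image_singleton, QuotientGroup.preimage_image_mk_eq_mul]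
  exact isCompact_singleton.mul hK

theorem IsQuotientMeasure.lintegral_of_hasCompactSupport (hmu : IsQuotientMeasure K lam lamK mu)
    (hK : IsCompact (K : Set G)) {F : G ⧸ K → ℝ} (hF : Continuous F) (hFc : HasCompactSupport F)
    (h0 : ∀ x, 0 ≤ F x) :
    ∫⁻ x, ENNReal.ofReal (F x) ∂mu = ∫⁻ g : G, ENNReal.ofReal (F g) ∂lam := by
  have := hmu.regular
  have hc : Continuous fun g : G => F g := hF.comp QuotientGroup.continuous_mk
  have hcc : HasCompactSupport fun g : G => F g := by
    have hpre := (isProperMap_quotientMk hK).isCompact_preimage hFc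
    refine HasCompactSupport.intro hpre fun x hx => ?_
    by_contra hne
    exact hx (subset_tsupport F hne)
  have h1 := hmu.integral_eq _ hc hcc
  -- The integrand is constant on cosets and `lamK` has mass 1, so the inner integral disappears.
  have h2 : ∀ (x : G ⧸ K) (k : K), F ((Quotient.out x * (k : G) : G) : G ⧸ K) = F x := by
    intro x k
    rw [QuotientGroup.mk_mul_of_mem _ k.2]
    congr 1
    exact Quotient.out_eq' x
  simp only [h2, integral_const, probReal_univ, one_smul] at h1
  rw [← ofReal_integral_eq_lintegral_ofReal (hF.integrable_of_hasCompactSupport hFc)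
    (Eventually.of_forall h0),
    ← ofReal_integral_eq_lintegral_ofReal (hc.integrable_of_hasCompactSupport hcc)
    (Eventually.of_forall fun g => h0 g), h1]

/-- Both sides are suprema over compact subsets; a Urysohn function between a compact set and `O`
compares them. Compact subsets of the preimage are first projected to `G/K`. -/
theorem IsQuotientMeasure.measure_isOpen (hmu : IsQuotientMeasure K lam lamK mu)
    (hK : IsCompact (K : Set G)) {O : Set (G ⧸ K)} (hO : IsOpen O) :
    mu O = lam (((↑) : G → G ⧸ K) ⁻¹' O) := by
  have := hmu.regular
  have hKc : IsClosed (K : Set G) := hK.isClosed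
  have hOp : IsOpen (((↑) : G → G ⧸ K) ⁻¹' O) := hO.preimage QuotientGroup.continuous_mk
  have key : ∀ C ⊆ O, IsCompact C → ∃ F : G ⧸ K → ℝ, Continuous F ∧ HasCompactSupport F ∧
      (∀ x, 0 ≤ F x) ∧ (∀ x, C.indicator 1 x ≤ ENNReal.ofReal (F x)) ∧
      ∀ x, ENNReal.ofReal (F x) ≤ O.indicator 1 x := by
    intro C hCO hC
    obtain ⟨F, hF1, hF0, hFc, hF⟩ := exists_continuous_one_zero_of_isCompact hC
      hO.isClosed_compl (Set.disjoint_compl_right_iff_subset.2 hCO)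
    refine ⟨F, F.continuous, hFc, fun x => (hF x).1, fun x => ?_, fun x => ?_⟩
    · by_cases hx : x ∈ C
      · simp [hx, hF1 hx]
      · simp [hx]
    · by_cases hx : x ∈ O
      · simpa [hx] using (hF x).2
      · simp [hx, hF0 hx]
  refine le_antisymm ?_ ?_
  · rw [hO.measure_eq_iSup_isCompact]
    refine iSup₂_le fun C hCO => iSup_le fun hC => ?_
    obtain ⟨F, hF, hFc, h0, hl, hu⟩ := key C hCO hC
    calc mu C = ∫⁻ x, C.indicator 1 x ∂mu := (lintegral_indicator_one hC.measurableSet).symm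
      _ ≤ ∫⁻ x, ENNReal.ofReal (F x) ∂mu := lintegral_mono hl
      _ = ∫⁻ g : G, ENNReal.ofReal (F g) ∂lam := hmu.lintegral_of_hasCompactSupport hK hF hFc h0
      _ ≤ ∫⁻ g : G, (((↑) : G → G ⧸ K) ⁻¹' O).indicator 1 g ∂lam := lintegral_mono fun g => hu g
      _ = _ := lintegral_indicator_one hOp.measurableSet
  · rw [hOp.measure_eq_iSup_isCompact]
    refine iSup₂_le fun C hCO => iSup_le fun hC => ?_
    obtain ⟨F, hF, hFc, h0, hl, hu⟩ := key (((↑) : G → G ⧸ K) '' C) (Set.image_subset_iff.2 hCO)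
      (hC.image QuotientGroup.continuous_mk)
    calc lam C = ∫⁻ x, C.indicator 1 x ∂lam := (lintegral_indicator_one hC.measurableSet).symm
      _ ≤ ∫⁻ g : G, ENNReal.ofReal (F g) ∂lam := lintegral_mono fun g => by
        by_cases hg : g ∈ C
        · have := hl g
          rw [Set.indicator_of_mem (Set.mem_image_of_mem _ hg)] at this
          simpa [hg] using this
        · simp [hg]
      _ = ∫⁻ x, ENNReal.ofReal (F x) ∂mu :=
        (hmu.lintegral_of_hasCompactSupport hK hF hFc h0).symm
      _ ≤ ∫⁻ x, O.indicator 1 x ∂mu := lintegral_mono hu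
      _ = mu O := lintegral_indicator_one hO.measurableSet

/-- The layer-cake formula reduces the claim to the open superlevel sets of `F`, without compact
support or σ-finiteness. -/
theorem IsQuotientMeasure.lintegral_ofReal (hmu : IsQuotientMeasure K lam lamK mu)
    (hK : IsCompact (K : Set G)) {F : G ⧸ K → ℝ} (hF : Continuous F) :
    ∫⁻ x, ENNReal.ofReal (F x) ∂mu = ∫⁻ g : G, ENNReal.ofReal (F g) ∂lam := by
  have hm : Continuous fun x => max (F x) 0 := hF.max continuous_const
  have hm' : Continuous fun g : G => max (F g) 0 := hm.comp QuotientGroup.continuous_mk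
  have h1 := lintegral_eq_lintegral_meas_lt mu (f := fun x => max (F x) 0)
    (Eventually.of_forall fun x => le_max_right _ _) hm.measurable.aemeasurable
  have h2 := lintegral_eq_lintegral_meas_lt lam (f := fun g : G => max (F g) 0)
    (Eventually.of_forall fun x => le_max_right _ _) hm'.measurable.aemeasurable
  have h3 : ∀ r : ℝ, ENNReal.ofReal (max r 0) = ENNReal.ofReal r := fun r => by
    rw [ENNReal.ofReal_max, ENNReal.ofReal_zero, max_eq_left (zero_le : (0 : ℝ≥0∞) ≤ _)]
  simp only [h3] at h1 h2
  rw [h1, h2]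
  refine lintegral_congr fun t => ?_
  rw [hmu.measure_isOpen hK (isOpen_lt continuous_const hm)]
  rfl

/-- Integrals of invariant kernels over `G/K` as integrals over `G`. -/
theorem IsQuotientMeasure.lintegral_kernel (hmu : IsQuotientMeasure K lam lamK mu)
    (hK : IsCompact (K : Set G)) {Phi : G ⧸ K → G ⧸ K → ℝ}
    (hc : Continuous (Function.uncurry Phi)) (hinv : IsInvariantKernel Phi) (x : G ⧸ K) :
    ∫⁻ y, ENNReal.ofReal (Phi x y) ∂mu =
      ∫⁻ g : G, ENNReal.ofReal (Phi ((1 : G) : G ⧸ K) (g : G ⧸ K)) ∂lam := by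
  obtain ⟨s, rfl⟩ := QuotientGroup.mk_surjective x
  have hcs : Continuous (Phi (s : G ⧸ K)) := hc.comp (Continuous.prodMk_right _)
  rw [hmu.lintegral_ofReal hK hcs, ← lintegral_mul_left_eq_self _ s]
  refine lintegral_congr fun g => ?_
  have := hinv s ((1 : G) : G ⧸ K) (g : G ⧸ K)
  rw [← this]
  simp [MulAction.Quotient.smul_mk]

end Quotient

/-! ### Kernels on `G/K` versus functions on `G` -/

section Kernel

variable {G : Type u} [Group G] [TopologicalSpace G] [IsTopologicalGroup G] {K : Subgroup G}
  {U V : Set G}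

theorem IsInvariantKernel.apply_mk {Phi : G ⧸ K → G ⧸ K → ℝ} (h : IsInvariantKernel Phi)
    (x y : G) : Phi (x : G ⧸ K) (y : G ⧸ K) = Phi ((1 : G) : G ⧸ K) ((x⁻¹ * y : G) : G ⧸ K) := by
  rw [← h x⁻¹]
  simp [MulAction.Quotient.smul_mk]

/-- The function on `G` belonging to an admissible kernel. -/
theorem IsAdmissible.isAdmissibleFunction {Phi : G ⧸ K → G ⧸ K → ℝ} (h : IsAdmissible U V Phi) :
    IsAdmissibleFunction K U V fun g => Phi ((1 : G) : G ⧸ K) (g : G ⧸ K) where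
  continuous := h.continuous.comp
    ((Continuous.prodMk_right _).comp QuotientGroup.continuous_mk)
  gram := by
    obtain ⟨H, i1, i2, i3, v, hv⟩ := h.posDef.exists_gram
    exact ⟨H, i1, i2, i3, fun g => v g, fun x y => by rw [hv, h.invariant.apply_mk]⟩
  map_one := h.diag _
  left_inv k hk g := by
    have h1 := h.invariant.apply_mk k⁻¹ g
    rw [inv_inv] at h1
    rw [← h1]
    congr 1
    exact QuotientGroup.eq.2 (by simpa using hk)
  nonpos g hg := by
    by_contra! hpos
    refine hg (h.supp_pos (subset_closure ?_))
    exact (lt_max_of_lt_left hpos).ne'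
  nonneg g hg := by
    by_contra! hneg
    refine hg (h.supp_neg (subset_closure ?_))
    exact (lt_max_of_lt_left (neg_pos.2 hneg)).ne'

/-- Inversion symmetry exchanges left and right invariance. -/
theorem IsAdmissibleFunction.right_inv {phi : G → ℝ} (h : IsAdmissibleFunction K U V phi)
    {k : G} (hk : k ∈ K) (g : G) : phi (g * k) = phi g := by
  rw [← h.gram.inv_apply, mul_inv_rev, h.left_inv _ (K.inv_mem hk), h.gram.inv_apply]

/-- The kernel on `G/K` belonging to an admissible function. -/
theorem IsAdmissibleFunction.exists_isAdmissible (hU : IsClosed U) (hV : IsClosed V) {phi : G → ℝ}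
    (h : IsAdmissibleFunction K U V phi) :
    ∃ Phi : G ⧸ K → G ⧸ K → ℝ, IsAdmissible U V Phi ∧
      ∀ g : G, Phi ((1 : G) : G ⧸ K) (g : G ⧸ K) = phi g := by
  let Phi : G ⧸ K → G ⧸ K → ℝ := fun p q => phi ((Quotient.out p)⁻¹ * Quotient.out q)
  have hPhi : ∀ x y : G, Phi (x : G ⧸ K) (y : G ⧸ K) = phi (x⁻¹ * y) := by
    intro x y
    obtain ⟨k, hk⟩ := QuotientGroup.mk_out_eq_mul K x
    obtain ⟨l, hl⟩ := QuotientGroup.mk_out_eq_mul K y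
    change phi ((Quotient.out (x : G ⧸ K))⁻¹ * Quotient.out (y : G ⧸ K)) = _
    rw [hk, hl, ← mul_assoc, h.right_inv l.2, mul_inv_rev, mul_assoc,
      h.left_inv _ (K.inv_mem k.2)]
  have hPhi1 : ∀ g : G, Phi ((1 : G) : G ⧸ K) (g : G ⧸ K) = phi g := fun g => by
    rw [hPhi, inv_one, one_mul]
  refine ⟨Phi, ⟨?_, ?_, ?_, ?_, ?_, ?_⟩, hPhi1⟩
  -- Continuity can be tested on `G × G`, since a product of open quotient maps is again one.
  · rw [← (QuotientGroup.isOpenQuotientMap_mk.prodMap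
      QuotientGroup.isOpenQuotientMap_mk).continuous_comp_iff]
    have h1 : Continuous fun p : G × G => phi (p.1⁻¹ * p.2) := h.continuous.comp (by fun_prop)
    convert h1 using 1
    ext p
    exact hPhi p.1 p.2
  · obtain ⟨H, i1, i2, i3, v, hv⟩ := h.gram
    exact isPosDefKernel_of_gram (fun p => v (Quotient.out p)) fun p q => hv _ _
  · intro g x y
    obtain ⟨x, rfl⟩ := QuotientGroup.mk_surjective x
    obtain ⟨y, rfl⟩ := QuotientGroup.mk_surjective y
    rw [MulAction.Quotient.smul_coe, MulAction.Quotient.smul_coe, hPhi, hPhi]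
    simp [mul_assoc]
  · intro x
    obtain ⟨x, rfl⟩ := QuotientGroup.mk_surjective x
    rw [hPhi, inv_mul_cancel, h.map_one]
  · refine closure_minimal (fun g hg => ?_) hU
    by_contra hgU
    refine hg (max_eq_right ?_)
    rw [hPhi1]
    exact h.nonpos g hgU
  · refine closure_minimal (fun g hg => ?_) hV
    by_contra hgV
    refine hg (max_eq_right ?_)
    rw [hPhi1]
    exact neg_nonpos.2 (h.nonneg g hgV)

end Kernel

/-! ### The extended integral -/

section ExtIntegral

variable {X : Type*} [MeasurableSpace X] {mu : Measure X} {f : X → ℝ}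

theorem extIntegral_eq_integral (hf : Integrable f mu) :
    extIntegral mu f = ((∫ x, f x ∂mu : ℝ) : EReal) := by
  have h1 : ∫⁻ x, ENNReal.ofReal (f x) ∂mu ≠ ∞ := hf.lintegral_lt_top.ne
  have h2 : ∫⁻ x, ENNReal.ofReal (-f x) ∂mu ≠ ∞ := hf.neg.lintegral_lt_top.ne
  rw [integral_eq_lintegral_pos_part_sub_lintegral_neg_part hf, extIntegral, EReal.coe_sub,
    EReal.coe_ennreal_toReal h1, EReal.coe_ennreal_toReal h2]

/-- An infinite negative part would make the extended integral `⊥`. -/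
theorem integrable_of_extIntegral_pos (hm : AEStronglyMeasurable f mu)
    (hfin : ∫⁻ x, ENNReal.ofReal (f x) ∂mu ≠ ∞) (hpos : 0 < extIntegral mu f) :
    Integrable f mu := by
  refine ⟨hm, ?_⟩
  have h2 : ∫⁻ x, ENNReal.ofReal (-f x) ∂mu ≠ ∞ := by
    intro htop
    rw [extIntegral, htop, EReal.coe_ennreal_top, EReal.sub_top] at hpos
    exact not_lt_bot hpos
  have h3 : ∀ x, ‖f x‖ₑ ≤ ENNReal.ofReal (f x) + ENNReal.ofReal (-f x) := fun x => by
    rw [← ofReal_norm, Real.norm_eq_abs]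
    rcases abs_cases (f x) with ⟨h, -⟩ | ⟨h, -⟩ <;> rw [h]
    · exact le_self_add
    · exact le_add_self
  refine (lintegral_mono h3).trans_lt ?_
  rw [lintegral_add_left' hm.aemeasurable.ennreal_ofReal]
  exact ENNReal.add_lt_top.2 ⟨hfin.lt_top, h2.lt_top⟩

end ExtIntegral

end Delsarte

/-! ### The theorem on `G/K` -/

open Delsarte

theorem mainTheorem2 {G : Type*} [Group G] [TopologicalSpace G] [IsTopologicalGroup G]
    [LocallyCompactSpace G] [T2Space G] [MeasurableSpace G] [BorelSpace G]
    (lam : Measure G) [lam.IsHaarMeasure] [lam.Regular]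
    (hG : Delsarte.IsAmenable lam)
    (K : Subgroup G) (hK : IsCompact (K : Set G))
    (lamK : Measure K) [lamK.IsHaarMeasure] [IsProbabilityMeasure lamK]
    [MeasurableSpace (G ⧸ K)] [BorelSpace (G ⧸ K)]
    (mu : Measure (G ⧸ K)) (hmu : Delsarte.IsQuotientMeasure K lam lamK mu)
    (U V : Set G)
    (hU_closed : IsClosed U) (hU_bi : Delsarte.IsBiInvariant K U)
    (hU_symm : Delsarte.IsSymmetric U) (hU_nhds : U ∈ 𝓝 (1 : G)) (hU_fin : lam U < ∞)
    (hV_closed : IsClosed V) (hV_bi : Delsarte.IsBiInvariant K V)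
    (hV_symm : Delsarte.IsSymmetric V) :
    ∃ Phi : G ⧸ K → G ⧸ K → ℝ, Delsarte.IsAdmissible U V Phi ∧
      ∀ x : G ⧸ K, Integrable (Phi x) mu ∧
        ((∫ y, Phi x y ∂mu : ℝ) : EReal) = Delsarte.delsarteConstant mu U V x := by
  obtain ⟨phi₀, h₀, h₀nn⟩ := exists_nonneg_admissibleFunction lam hK (V := V) hU_nhds hU_bi
  obtain ⟨hi₀, hpos₀⟩ := h₀.integrable_and_pos hU_fin h₀nn
  obtain ⟨psi, hpsi, hipsi, hmax⟩ :=
    exists_maximal_admissibleFunction hU_closed hV_closed hU_fin h₀ hi₀ hpos₀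
  obtain ⟨Phi, hPhi, hPhi1⟩ := hpsi.exists_isAdmissible hU_closed hV_closed
  have hext : ∀ Psi : G ⧸ K → G ⧸ K → ℝ, IsAdmissible U V Psi → ∀ x, extIntegral mu (Psi x) =
      extIntegral lam fun g : G => Psi ((1 : G) : G ⧸ K) (g : G ⧸ K) := by
    intro Psi hPsi x
    have h1 := hmu.lintegral_kernel hK hPsi.continuous hPsi.invariant x
    -- The negative part is handled by the kernel `-Psi`, for which continuity and invariance
    -- suffice.
    have h2 := hmu.lintegral_kernel hK (Phi := fun p q => -Psi p q) hPsi.continuous.neg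
      (fun g p q => congrArg Neg.neg (hPsi.invariant g p q)) x
    rw [extIntegral, extIntegral, h1, h2]
  have hfinpos : ∀ phi : G → ℝ, IsAdmissibleFunction K U V phi →
      ∫⁻ g, ENNReal.ofReal (phi g) ∂lam ≠ ∞ := by
    intro phi hphi
    refine ne_top_of_le_ne_top hU_fin.ne ?_
    rw [← lintegral_indicator_one hU_closed.measurableSet]
    refine lintegral_mono fun g => ?_
    by_cases hg : g ∈ U
    · simpa [hg] using (le_abs_self _).trans (hphi.abs_le g)
    · simpa [hg] using hphi.nonpos g hg
  have hvalue : extIntegral lam psi = ((∫ g, psi g ∂lam : ℝ) : EReal) :=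
    extIntegral_eq_integral hipsi
  have hpos : 0 < ∫ g, psi g ∂lam := hpos₀.trans_le (hmax phi₀ h₀ hi₀)
  refine ⟨Phi, hPhi, fun x => ?_⟩
  have hx : extIntegral mu (Phi x) = ((∫ g, psi g ∂lam : ℝ) : EReal) := by
    rw [hext Phi hPhi x, ← hvalue]
    simp only [hPhi1]
  have hint : Integrable (Phi x) mu := by
    have hc : Continuous (Phi x) := hPhi.continuous.comp (Continuous.prodMk_right x)
    refine integrable_of_extIntegral_pos hc.aestronglyMeasurable ?_ ?_
    · rw [hmu.lintegral_kernel hK hPhi.continuous hPhi.invariant x]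
      exact hfinpos _ hPhi.isAdmissibleFunction
    · rw [hx]
      exact_mod_cast hpos
  refine ⟨hint, ?_⟩
  rw [← extIntegral_eq_integral hint]
  refine le_antisymm (le_iSup₂_of_le Phi hPhi le_rfl) (iSup₂_le fun Psi hPsi => ?_)
  rw [hx, hext Psi hPsi x]
  -- The maximum over integrable functions is positive, so kernels of nonpositive extended integral,
  -- including `⊥`, cannot exceed it; all others are integrable.
  rcases le_or_gt (extIntegral lam fun g : G => Psi ((1 : G) : G ⧸ K) (g : G ⧸ K)) 0 with hle | hgt
  · exact hle.trans (by exact_mod_cast hpos.le)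
  · have hf := hPsi.isAdmissibleFunction
    have hi := integrable_of_extIntegral_pos hf.continuous.aestronglyMeasurable (hfinpos _ hf) hgt
    rw [extIntegral_eq_integral hi]
    exact_mod_cast hmax _ hf hi
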